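/- \textbf{Theorem (Partition Property).} A finite lattice $K$ is called \emph{semimodular} if $a \wedge b \prec a$ implies $b \prec a \vee b$ for all $a, b \in K$ (where $\prec$ is the covering relation). It is called \emph{planar} if it has a planar Hasse diagram, that is, its elements can be placed at distinct points of the plane so that each covering pair $a \prec b$ is drawn as a straight line segment going strictly upwards from $a$ to $b$, no segment passes through an element other than its two ends, and two distinct segments meet only in common ends. A finite planar semimodular lattice is called \emph{slim} if it has no sublattice isomorphic to the five-element modular nondistributive lattice $\mathsf{M}_3$. Let $K$ be a slim planar semimodular (finite) lattice with at least three elements, and let $P$ be the ordered set of join-irreducible elements of the congruence lattice $\operatorname{Con} K$ (the congruences of $K$ ordered by inclusion), with the order inherited from $\operatorname{Con} K$; the least congruence does not count as join-irreducible. Then the set of maximal elements of $P$ is the disjoint union of two nonempty subsets $A$ and $B$ such that for any two distinct elements $x, y \in A$, and also for any two distinct elements $x, y \in B$, there is no $z \in P$ with $z \prec x$ and $z \prec y$ in $P$. -/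

import Mathlib

/-- Congruences of a lattice are ordered by inclusion of relations. -/
instance LatticeCon.instPartialOrder {K : Type*} [Lattice K] : PartialOrder (LatticeCon K) where
  le c d := ∀ x y : K, c.r x y → d.r x y
  le_refl _ _ _ h := h
  le_trans _ _ _ h₁ h₂ x y h := h₂ x y (h₁ x y h)
  le_antisymm c d h₁ h₂ := by
    obtain ⟨c, _, _⟩ := c
    obtain ⟨d, _, _⟩ := d
    obtain rfl : c = d := Setoid.ext fun x y => ⟨h₁ x y, h₂ x y⟩
    rfl

/-- The infimum of a set of congruences is their intersection. -/
instance LatticeCon.instInfSet {K : Type*} [Lattice K] : InfSet (LatticeCon K) where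
  sInf S :=
    { r := fun x y => ∀ c ∈ S, c.r x y
      iseqv :=
        { refl := fun x c _ => c.iseqv.refl x
          symm := fun h c hc => c.iseqv.symm (h c hc)
          trans := fun h₁ h₂ c hc => c.iseqv.trans (h₁ c hc) (h₂ c hc) }
      inf := fun h₁ h₂ c hc => c.inf (h₁ c hc) (h₂ c hc)
      sup := fun h₁ h₂ c hc => c.sup (h₁ c hc) (h₂ c hc) }

/-- The congruence lattice `Con K`; the lattice operations are determined by the inclusion order. -/
noncomputable instance LatticeCon.instCompleteLattice {K : Type*} [Lattice K] :
    CompleteLattice (LatticeCon K) :=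
  completeLatticeOfInf (LatticeCon K) fun _ =>
    ⟨fun c hc _ _ h => h c hc, fun _ hd x y h c hc => hd hc x y h⟩

/-- The ordered set of join-irreducible congruences of `K`, with the order inherited from
`Con K`. The least congruence is not join-irreducible. -/
abbrev JoinIrredCon (K : Type*) [Lattice K] : Type _ :=
  {c : LatticeCon K // SupIrred c}

/-- `pos` is a planar (Hasse) diagram of the ordered set `α`: distinct elements are drawn at
distinct points of the plane, each covering pair `a ⋖ b` is drawn as a straight line segment going
strictly upwards from `a` to `b`, such a segment meets no element other than its two ends, and two
different segments have no point in common except a common end. -/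
structure IsPlanarDiagram {α : Type*} [PartialOrder α] (pos : α → ℝ × ℝ) : Prop where
  injective : Function.Injective pos
  up : ∀ ⦃a b : α⦄, a ⋖ b → (pos a).2 < (pos b).2
  vertex : ∀ ⦃a b v : α⦄, a ⋖ b → pos v ∈ segment ℝ (pos a) (pos b) → v = a ∨ v = b
  edge : ∀ ⦃a b c d : α⦄, a ⋖ b → c ⋖ d → (a ≠ c ∨ b ≠ d) →
    ∀ p ∈ segment ℝ (pos a) (pos b), p ∈ segment ℝ (pos c) (pos d) →
      ∃ v, (v = a ∨ v = b) ∧ (v = c ∨ v = d) ∧ p = pos v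

/-- An ordered set is planar if it has a planar diagram. -/
def IsPlanarOrder (α : Type*) [PartialOrder α] : Prop :=
  ∃ pos : α → ℝ × ℝ, IsPlanarDiagram pos

/-- `K` has a sublattice isomorphic to the five-element modular nondistributive lattice `M₃`,
with bottom `o`, top `i` and atoms `a`, `b`, `c`. -/
def HasM3Sublattice (K : Type*) [Lattice K] : Prop :=
  ∃ o a b c i : K, (o < a ∧ a < i) ∧ (o < b ∧ b < i) ∧ (o < c ∧ c < i) ∧
    (a ⊓ b = o ∧ a ⊓ c = o ∧ b ⊓ c = o) ∧ (a ⊔ b = i ∧ a ⊔ c = i ∧ b ⊔ c = i)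

/-- A slim, planar, semimodular (SPS) lattice: a finite planar semimodular lattice that has no
`M₃` sublattice. `IsUpperModularLattice` is (upper) semimodularity. -/
structure IsSPSLattice (K : Type*) [Lattice K] : Prop where
  finite : Finite K
  planar : IsPlanarOrder K
  semimodular : IsUpperModularLattice K
  slim : ¬ HasM3Sublattice K

/-!
The proof represents the lattice by a permutation diagram and reads the congruences off from it.

In a planar diagram every element lies on an ascending path from bottom to top, the graph of a
continuous function of the height. The side of that path on which an incomparable element lies
defines a "left of" relation (`IsPlanarDiagram.exists_isLeftOf`); its few properties follow from the
intermediate value theorem, since crossing paths share a vertex. In a semimodular lattice, three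
upper covers of an element that lie from left to right generate an `M₃`
(`IsLeftOf.not_covBy_of_between`). Hence every join-irreducible element belongs to the chain `C` of
leftmost or to the chain `D` of rightmost elements (`IsLeftOf.forall_not_or_forall_not`). The number
`l x` of elements of `C` below `x` and the number `r x` of elements of `D` below `x` are therefore
coordinates that determine the order and turn meets into minima. On the meet-irreducible elements
each of the two coordinates is injective (`IsLeftOf.leftCoord_injOn`), so that these elements form
the points of a permutation diagram. From here on only `IsCoordPair` is used.

A congruence is determined by the set of meet-irreducible elements that it collapses, and the sets
that occur are those closed under the explicit relation `Forces` between points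
(`IsCoordPair.collapses_of_forces`, `IsCoordPair.exists_collapses_iff`). So the join-irreducible
congruences are the classes of points under the reachability preorder of `Forces`. A forced point
always has a point to its upper left and a point to its lower right, whereas a point that has both
is forced by a boundary point. Hence the maximal join-irreducible congruences correspond to the
points on the upper left or on the lower right boundary (`IsCoordPair.isMax_iff`), and these two
boundaries give the sets `A` and `B`. If a lower cover of the congruence of an upper left boundary
point `x` is generated by a point `e` forced by `x`, then `x` is the highest point to the left of
`e`; the height of that point does not increase along `Forces`, so it is an invariant of the
congruence generated by `e`, and the lower cover determines `x` (`IsCoordPair.eq_of_covBy_of_covBy`).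
-/

/-! ### Paths in a planar diagram and the left-of relation -/

/-- The part of the diagram between `a` and `b`: the union of the drawn edges and vertices of the
interval `[a, b]`. A vertex is the segment of the trivial weak covering `c ⩿ c`. -/
def diagramBetween {α : Type*} [PartialOrder α] (pos : α → ℝ × ℝ) (a b : α) : Set (ℝ × ℝ) :=
  {p | ∃ c d, a ≤ c ∧ c ⩿ d ∧ d ≤ b ∧ p ∈ segment ℝ (pos c) (pos d)}

theorem diagramBetween_mono {α : Type*} [PartialOrder α] {pos : α → ℝ × ℝ} {a b a' b' : α}
    (ha : a' ≤ a) (hb : b ≤ b') : diagramBetween pos a b ⊆ diagramBetween pos a' b' :=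
  fun _ ⟨c, d, h₁, h₂, h₃, h₄⟩ => ⟨c, d, ha.trans h₁, h₂, h₃.trans hb, h₄⟩

theorem pos_mem_diagramBetween {α : Type*} [PartialOrder α] {pos : α → ℝ × ℝ} {a b v : α}
    (ha : a ≤ v) (hb : v ≤ b) : pos v ∈ diagramBetween pos a b :=
  ⟨v, v, ha, WCovBy.rfl, hb, left_mem_segment ℝ _ _⟩

/-- Two functions that agree at `b` can be glued to a continuous function. -/
theorem exists_continuousOn_glue {f g : ℝ → ℝ} {a b c : ℝ} (hab : a ≤ b) (hbc : b ≤ c)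
    (hf : ContinuousOn f (Set.Icc a b)) (hg : ContinuousOn g (Set.Icc b c)) (h : f b = g b) :
    ∃ k : ℝ → ℝ, ContinuousOn k (Set.Icc a c) ∧ (∀ t ∈ Set.Icc a b, k t = f t) ∧
      ∀ t ∈ Set.Icc b c, k t = g t := by
  have h₁ : ∀ t ∈ Set.Icc a b, (if t ≤ b then f t else g t) = f t := fun t ht => if_pos ht.2
  have h₂ : ∀ t ∈ Set.Icc b c, (if t ≤ b then f t else g t) = g t := by
    intro t ht
    rcases ht.1.eq_or_lt with rfl | hlt
    · rw [if_pos le_rfl, h]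
    · exact if_neg hlt.not_ge
  refine ⟨fun t => if t ≤ b then f t else g t, ?_, h₁, h₂⟩
  rw [← Set.Icc_union_Icc_eq_Icc hab hbc]
  exact (hf.congr h₁).union_of_isClosed (hg.congr h₂) isClosed_Icc isClosed_Icc

/-- A continuous function without zeros on an interval does not change its sign. -/
theorem neg_of_neg_of_forall_ne_zero {h : ℝ → ℝ} {s t : ℝ} (hc : ContinuousOn h (Set.uIcc s t))
    (h0 : ∀ u ∈ Set.uIcc s t, h u ≠ 0) (hs : h s < 0) : h t < 0 := by
  by_contra! ht
  obtain ⟨u, hu, hu0⟩ := intermediate_value_uIcc hc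
    (Set.mem_uIcc_of_le hs.le ht : (0 : ℝ) ∈ Set.uIcc (h s) (h t))
  exact h0 u hu hu0

namespace IsPlanarDiagram

variable {α : Type*} [PartialOrder α] {pos : α → ℝ × ℝ}

/-- Two edges or vertices of a planar diagram meet only in a common end. -/
theorem exists_common_end (hp : IsPlanarDiagram pos) {a b c d : α} (hab : a ⩿ b) (hcd : c ⩿ d)
    {p : ℝ × ℝ} (h₁ : p ∈ segment ℝ (pos a) (pos b)) (h₂ : p ∈ segment ℝ (pos c) (pos d)) :
    ∃ v, (v = a ∨ v = b) ∧ (v = c ∨ v = d) := by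
  rcases hab.covBy_or_eq with hab | rfl
  · rcases hcd.covBy_or_eq with hcd | rfl
    · by_cases h : a ≠ c ∨ b ≠ d
      · obtain ⟨v, hv₁, hv₂, -⟩ := hp.edge hab hcd h p h₁ h₂
        exact ⟨v, hv₁, hv₂⟩
      · push Not at h
        exact ⟨a, .inl rfl, .inl h.1⟩
    · rw [segment_same, Set.mem_singleton_iff] at h₂
      subst h₂
      exact ⟨c, hp.vertex hab h₁, .inl rfl⟩
  · rw [segment_same, Set.mem_singleton_iff] at h₁
    subst h₁
    rcases hcd.covBy_or_eq with hcd | rfl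
    · exact ⟨a, .inl rfl, hp.vertex hcd h₂⟩
    · rw [segment_same, Set.mem_singleton_iff] at h₂
      exact ⟨a, .inl rfl, .inl (hp.injective h₂)⟩

/-- If the drawings of two intervals meet, then the intervals have a common element. -/
theorem exists_mem_of_mem_diagramBetween (hp : IsPlanarDiagram pos) {a b c d : α} {p : ℝ × ℝ}
    (h₁ : p ∈ diagramBetween pos a b) (h₂ : p ∈ diagramBetween pos c d) :
    ∃ v, (a ≤ v ∧ v ≤ b) ∧ (c ≤ v ∧ v ≤ d) := by
  obtain ⟨a', b', ha, hab, hb, h₁⟩ := h₁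
  obtain ⟨c', d', hc, hcd, hd, h₂⟩ := h₂
  obtain ⟨v, hv₁, hv₂⟩ := hp.exists_common_end hab hcd h₁ h₂
  refine ⟨v, ?_, ?_⟩
  · rcases hv₁ with rfl | rfl
    exacts [⟨ha, hab.le.trans hb⟩, ⟨ha.trans hab.le, hb⟩]
  · rcases hv₂ with rfl | rfl
    exacts [⟨hc, hcd.le.trans hd⟩, ⟨hc.trans hcd.le, hd⟩]

/-- For `a ≤ b` there is an ascending path from `a` to `b` in the diagram. It is given as the graph
of the first coordinate as a continuous function of the height. -/
theorem exists_path [Finite α] (hp : IsPlanarDiagram pos) {a b : α} (hab : a ≤ b) :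
    (pos a).2 ≤ (pos b).2 ∧ ∃ f : ℝ → ℝ, ContinuousOn f (Set.Icc (pos a).2 (pos b).2) ∧
      f (pos a).2 = (pos a).1 ∧ f (pos b).2 = (pos b).1 ∧
      ∀ t ∈ Set.Icc (pos a).2 (pos b).2, (f t, t) ∈ diagramBetween pos a b := by
  induction a using WellFoundedGT.induction with
  | ind a ih =>
    rcases hab.eq_or_lt with rfl | hlt
    · refine ⟨le_rfl, fun _ => (pos a).1, continuousOn_const, rfl, rfl, fun t ht => ?_⟩
      obtain rfl : t = (pos a).2 := le_antisymm ht.2 ht.1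
      exact pos_mem_diagramBetween le_rfl le_rfl
    · obtain ⟨c, hac, hcb⟩ := exists_covBy_le_of_lt hlt
      obtain ⟨hle, g, hg, hgc, hgb, hgm⟩ := ih c hac.lt hcb
      have hup := hp.up hac
      have hne : (pos c).2 - (pos a).2 ≠ 0 := (sub_pos.2 hup).ne'
      let s : ℝ → ℝ := fun t => (t - (pos a).2) / ((pos c).2 - (pos a).2)
      have hsc : s (pos c).2 = 1 := div_self hne
      have hsa : s (pos a).2 = 0 := by simp [s]
      obtain ⟨k, hk, hk₁, hk₂⟩ := exists_continuousOn_glue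
        (f := fun t => (pos a).1 + s t * ((pos c).1 - (pos a).1)) hup.le hle
        (by fun_prop) hg (by rw [hgc, hsc]; ring)
      refine ⟨hup.le.trans hle, k, hk, ?_, ?_, fun t ht => ?_⟩
      · rw [hk₁ _ ⟨le_rfl, hup.le⟩, hsa]; ring
      · rw [hk₂ _ ⟨hle, le_rfl⟩, hgb]
      · rcases le_total t (pos c).2 with htc | htc
        · rw [hk₁ t ⟨ht.1, htc⟩]
          refine ⟨a, c, le_rfl, hac.wcovBy, hcb, 1 - s t, s t, ?_, ?_, by ring, ?_⟩
          · rw [sub_nonneg]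
            exact (div_le_one (sub_pos.2 hup)).2 (by linarith)
          · exact div_nonneg (by linarith [ht.1]) (by linarith)
          · have hst : s t * ((pos c).2 - (pos a).2) = t - (pos a).2 := div_mul_cancel₀ _ hne
            ext
            · simp; ring
            · simp; linarith
        · rw [hk₂ t ⟨htc, ht.2⟩]
          exact diagramBetween_mono hac.le le_rfl (hgm t ⟨htc, ht.2⟩)

/-- Every element of a finite bounded planar ordered set lies on an ascending path from bottom to
top, all of whose vertices are comparable to that element. -/
theorem exists_path_through [Finite α] [BoundedOrder α] (hp : IsPlanarDiagram pos) (b : α) :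
    ∃ f : ℝ → ℝ, ContinuousOn f (Set.Icc (pos ⊥).2 (pos ⊤).2) ∧ f (pos b).2 = (pos b).1 ∧
      (∀ t ∈ Set.Icc (pos ⊥).2 (pos b).2, (f t, t) ∈ diagramBetween pos ⊥ b) ∧
      ∀ t ∈ Set.Icc (pos b).2 (pos ⊤).2, (f t, t) ∈ diagramBetween pos b ⊤ := by
  obtain ⟨h₁, f, hf, -, hfb, hfm⟩ := hp.exists_path (bot_le (a := b))
  obtain ⟨h₂, g, hg, hgb, -, hgm⟩ := hp.exists_path (le_top (a := b))
  obtain ⟨k, hk, hk₁, hk₂⟩ := exists_continuousOn_glue h₁ h₂ hf hg (hfb.trans hgb.symm)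
  refine ⟨k, hk, ?_, fun t ht => ?_, fun t ht => ?_⟩
  · rw [hk₁ _ ⟨h₁, le_rfl⟩, hfb]
  · rw [hk₁ t ht]; exact hfm t ht
  · rw [hk₂ t ht]; exact hgm t ht

end IsPlanarDiagram

/-- The properties of the relation "`a` is to the left of `b`" of a planar diagram that are used
below: it decides between any two incomparable elements, and moving `a` along the order without
becoming comparable to `b` does not change the side of `b`. -/
structure IsLeftOf {α : Type*} [PartialOrder α] (L : α → α → Prop) : Prop where
  incomp : ∀ ⦃a b⦄, L a b → ¬ a ≤ b ∧ ¬ b ≤ a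
  iff_not : ∀ ⦃a b⦄, ¬ a ≤ b → ¬ b ≤ a → (L a b ↔ ¬ L b a)
  move : ∀ ⦃a a' b⦄, L a b → a ≤ a' ∨ a' ≤ a → ¬ a' ≤ b → ¬ b ≤ a' → L a' b

theorem IsLeftOf.flip {α : Type*} [PartialOrder α] {L : α → α → Prop} (hL : IsLeftOf L) :
    IsLeftOf fun a b => L b a where
  incomp a b h := (hL.incomp h).symm
  iff_not a b h₁ h₂ := hL.iff_not h₂ h₁
  move a a' b h h₁ h₂ h₃ := by
    by_contra h₄
    have h₅ := hL.move ((hL.iff_not h₂ h₃).2 h₄) h₁.symm (hL.incomp h).2 (hL.incomp h).1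
    exact (hL.iff_not (hL.incomp h).1 (hL.incomp h).2).1 h h₅

/-- The relation is the side of a path through `b`: an element incomparable to `b` is off
that path, and a path that avoids it stays on one side of it. -/
theorem IsPlanarDiagram.exists_isLeftOf {α : Type*} [PartialOrder α] [Finite α] [BoundedOrder α]
    {pos : α → ℝ × ℝ} (hp : IsPlanarDiagram pos) : ∃ L : α → α → Prop, IsLeftOf L := by
  choose F hF hFb hlow hhigh using hp.exists_path_through
  have hbot (a : α) : (pos ⊥).2 ≤ (pos a).2 := (hp.exists_path bot_le).1
  have htop (a : α) : (pos a).2 ≤ (pos ⊤).2 := (hp.exists_path le_top).1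
  have hsub (a b : α) : Set.uIcc (pos a).2 (pos b).2 ⊆ Set.Icc (pos ⊥).2 (pos ⊤).2 :=
    Set.uIcc_subset_Icc ⟨hbot a, htop a⟩ ⟨hbot b, htop b⟩
  -- The points of the path through `b` only belong to intervals with an element comparable to `b`.
  have hmeet (b : α) {c d : α} {t : ℝ} (ht : t ∈ Set.Icc (pos ⊥).2 (pos ⊤).2)
      (h : (F b t, t) ∈ diagramBetween pos c d) : ∃ v, c ≤ v ∧ v ≤ d ∧ (v ≤ b ∨ b ≤ v) := by
    rcases le_total t (pos b).2 with htb | htb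
    · obtain ⟨v, hv₁, hv₂⟩ := hp.exists_mem_of_mem_diagramBetween h (hlow b t ⟨ht.1, htb⟩)
      exact ⟨v, hv₁.1, hv₁.2, .inl hv₂.2⟩
    · obtain ⟨v, hv₁, hv₂⟩ := hp.exists_mem_of_mem_diagramBetween h (hhigh b t ⟨htb, ht.2⟩)
      exact ⟨v, hv₁.1, hv₁.2, .inr hv₂.1⟩
  have hoff {a b : α} (h₁ : ¬ a ≤ b) (h₂ : ¬ b ≤ a) : (pos a).1 ≠ F b (pos a).2 := by
    intro h
    obtain ⟨v, hv₁, hv₂, hv⟩ := hmeet b (c := a) (d := a) ⟨hbot a, htop a⟩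
      (by rw [← h]; exact pos_mem_diagramBetween le_rfl le_rfl)
    obtain rfl := le_antisymm hv₁ hv₂
    exact hv.elim h₁ h₂
  have hcross {a b : α} (h₁ : ¬ a ≤ b) (h₂ : ¬ b ≤ a) :
      ∀ t ∈ Set.uIcc (pos a).2 (pos b).2, F a t ≠ F b t := by
    intro t ht hab
    have ht' := hsub a b ht
    rcases le_total (pos a).2 (pos b).2 with hle | hle
    · rw [Set.uIcc_of_le hle] at ht
      have h := hlow b t ⟨ht'.1, ht.2⟩
      rw [← hab] at h
      obtain ⟨v, hv₁, hv₂⟩ := hp.exists_mem_of_mem_diagramBetween (hhigh a t ⟨ht.1, ht'.2⟩) h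
      exact h₁ (hv₁.1.trans hv₂.2)
    · rw [Set.uIcc_of_ge hle] at ht
      have h := hhigh b t ⟨ht.1, ht'.2⟩
      rw [← hab] at h
      obtain ⟨v, hv₁, hv₂⟩ := hp.exists_mem_of_mem_diagramBetween (hlow a t ⟨ht'.1, ht.2⟩) h
      exact h₂ (hv₂.1.trans hv₁.2)
  have hcont (a b : α) : ContinuousOn (fun t => F a t - F b t) (Set.uIcc (pos a).2 (pos b).2) :=
    ((hF a).sub (hF b)).mono (hsub a b)
  refine ⟨fun a b => (¬ a ≤ b ∧ ¬ b ≤ a) ∧ (pos a).1 < F b (pos a).2,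
    ⟨fun a b h => h.1, fun a b h₁ h₂ => ⟨fun h h' => ?_, fun h => ⟨⟨h₁, h₂⟩, ?_⟩⟩, ?_⟩⟩
  · have := neg_of_neg_of_forall_ne_zero (hcont a b)
      (fun t ht => sub_ne_zero.2 (hcross h₁ h₂ t ht)) (by simpa [hFb] using h.2)
    rw [sub_neg, hFb b] at this
    exact this.not_gt h'.2
  · by_contra h'
    have hlt : F b (pos a).2 < (pos a).1 := lt_of_le_of_ne (not_lt.1 h') (hoff h₁ h₂).symm
    have := neg_of_neg_of_forall_ne_zero (h := fun t => F b t - F a t)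
      (((hF b).sub (hF a)).mono (hsub a b))
      (fun t ht => sub_ne_zero.2 (hcross h₁ h₂ t ht).symm) (by simpa [hFb] using hlt)
    rw [sub_neg, hFb b] at this
    exact h ⟨⟨h₂, h₁⟩, this⟩
  · -- A path between `a` and `a'` has only vertices incomparable to `b`.
    have key : ∀ a a' b : α, ∀ c d : α, ¬ d ≤ b → ¬ b ≤ c → d ≤ c →
        ((a = c ∧ a' = d) ∨ (a = d ∧ a' = c)) → (pos a).1 < F b (pos a).2 →
        (pos a').1 < F b (pos a').2 := by
      intro a a' b c d hdb hbc hdc hcase hlt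
      obtain ⟨hle, f, hf, hfd, hfc, hfm⟩ := hp.exists_path hdc
      have hIcc : Set.uIcc (pos a).2 (pos a').2 = Set.Icc (pos d).2 (pos c).2 := by
        rcases hcase with ⟨rfl, rfl⟩ | ⟨rfl, rfl⟩
        exacts [Set.uIcc_of_ge hle, Set.uIcc_of_le hle]
      have hfa : f (pos a).2 = (pos a).1 := by
        rcases hcase with ⟨rfl, rfl⟩ | ⟨rfl, rfl⟩ <;> assumption
      have hfa' : f (pos a').2 = (pos a').1 := by
        rcases hcase with ⟨rfl, rfl⟩ | ⟨rfl, rfl⟩ <;> assumption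
      have := neg_of_neg_of_forall_ne_zero (h := fun t => f t - F b t)
        ((hIcc ▸ hf).sub ((hF b).mono (hsub a a'))) (fun t ht h0 => by
          have h := hfm t (hIcc ▸ ht)
          rw [sub_eq_zero.1 h0] at h
          obtain ⟨v, hv₁, hv₂, hv⟩ := hmeet b (hsub a a' ht) h
          exact hv.elim (fun h => hdb (hv₁.trans h)) fun h => hbc (h.trans hv₂))
        (by simpa [hfa] using hlt)
      rwa [sub_neg, hfa'] at this
    rintro a a' b ⟨⟨h₁, h₂⟩, hlt⟩ hcomp h₃ h₄
    refine ⟨⟨h₃, h₄⟩, ?_⟩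
    rcases hcomp with h | h
    · exact key a a' b a' a h₁ h₄ h (.inr ⟨rfl, rfl⟩) hlt
    · exact key a a' b a a' h₃ h₂ h (.inl ⟨rfl, rfl⟩) hlt

/-! ### Two chains that contain the join-irreducible elements -/

/-- In a finite lattice, meet-irreducible elements separate. -/
theorem exists_infIrred_of_not_le {K : Type*} [Lattice K] [Finite K] {x y : K} (h : ¬ x ≤ y) :
    ∃ m, InfIrred m ∧ y ≤ m ∧ ¬ x ≤ m := by
  obtain ⟨m, ⟨hym, hxm⟩, hmax⟩ :=
    (Set.toFinite {u : K | y ≤ u ∧ ¬ x ≤ u}).exists_maximal ⟨y, le_rfl, h⟩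
  refine ⟨m, ⟨fun hm => hxm (le_sup_right.trans (hm le_sup_left)), fun b c hbc => ?_⟩, hym, hxm⟩
  have key : ∀ u, m ≤ u → u ≠ m → x ≤ u := fun u hmu hne => by
    by_contra hxu
    exact hne (le_antisymm (hmax ⟨hym.trans hmu, hxu⟩ hmu) hmu)
  by_contra! hne
  exact hxm (hbc ▸ le_inf (key b (hbc ▸ inf_le_left) hne.1) (key c (hbc ▸ inf_le_right) hne.2))

/-- In a finite lattice, join-irreducible elements separate. -/
theorem exists_supIrred_of_not_le {K : Type*} [Lattice K] [Finite K] {x y : K} (h : ¬ x ≤ y) :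
    ∃ j, SupIrred j ∧ j ≤ x ∧ ¬ j ≤ y :=
  exists_infIrred_of_not_le (K := Kᵒᵈ) h

/-- In a finite lattice, a meet-irreducible element has a unique upper cover, and this cover is
below everything that is strictly above the element. -/
theorem InfIrred.exists_covBy {K : Type*} [Lattice K] [Finite K] {m : K} (hm : InfIrred m) :
    ∃ m', m ⋖ m' ∧ ∀ x, m < x → m' ≤ x := by
  obtain ⟨y, hy⟩ := not_isMax_iff.1 hm.1
  obtain ⟨u, hu, -⟩ := exists_covBy_le_of_lt hy
  refine ⟨u, hu, fun x hx => inf_eq_left.1 ?_⟩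
  refine ((hu.wcovBy.eq_or_eq (le_inf hu.le hx.le) inf_le_left).resolve_left fun h => ?_)
  rcases hm.2 h with rfl | rfl
  exacts [hu.lt.false, hx.false]

theorem SupIrred.exists_covBy {K : Type*} [Lattice K] [Finite K] {b : K} (hb : SupIrred b) :
    ∃ o, o ⋖ b ∧ ∀ x, x < b → x ≤ o := by
  obtain ⟨o, ho, h⟩ := InfIrred.exists_covBy (K := Kᵒᵈ) (m := b) hb
  exact ⟨o, ho.ofDual, h⟩

namespace IsLeftOf

variable {K : Type*} [Lattice K] {L : K → K → Prop}

/-- In a finite semimodular lattice, an element to the left of `b` can be replaced by an upper cover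
of a lower cover of `b`. -/
theorem exists_covBy_left [Finite K] [IsUpperModularLattice K] (hL : IsLeftOf L) {a b o : K}
    (hab : L a b) (hob : o ⋖ b) (ho : a ⊓ b ≤ o) : ∃ a', o ⋖ a' ∧ L a' b := by
  have hinc := hL.incomp hab
  obtain ⟨y, hy, hya⟩ := exists_covBy_le_of_lt (inf_lt_left.2 hinc.1)
  have hyb : ¬ y ≤ b := fun h => hy.lt.not_ge (le_inf hya h)
  have hby : ¬ b ≤ y := fun h => hinc.2 (h.trans hya)
  have hyo : y ⊓ o = a ⊓ b :=
    le_antisymm (le_inf (inf_le_left.trans hya) (inf_le_right.trans hob.le)) (le_inf hy.le ho)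
  have hcov : o ⋖ y ⊔ o := covBy_sup_of_inf_covBy_left (hyo ▸ hy)
  have h₁ : ¬ y ⊔ o ≤ b := fun h => hyb (le_sup_left.trans h)
  have h₂ : ¬ b ≤ y ⊔ o := fun h => by
    rcases hcov.wcovBy.eq_or_eq hob.le h with h | h
    · exact hob.lt.ne h.symm
    · exact h₁ h.ge
  exact ⟨y ⊔ o, hcov, hL.move (hL.move hab (.inr hya) hyb hby) (.inl le_sup_left) h₁ h₂⟩

theorem le_sup_of_between (hL : IsLeftOf L) {a b c : K} (hab : L a b) (hbc : L b c) :
    b ≤ a ⊔ c := by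
  by_contra h
  have h' : ¬ a ⊔ c ≤ b := fun h => (hL.incomp hab).1 (le_sup_left.trans h)
  exact (hL.iff_not h' h).1 (hL.move hab (.inl le_sup_left) h' h)
    (hL.flip.move hbc (.inl le_sup_right) h' h)

/-- In a slim semimodular lattice, no element has three upper covers that lie from left to right:
they would generate an `M₃`. -/
theorem not_covBy_of_between [IsUpperModularLattice K] (hL : IsLeftOf L)
    (hslim : ¬ HasM3Sublattice K) {o a b c : K} (hab : L a b) (hbc : L b c) (hoa : o ⋖ a)
    (hob : o ⋖ b) : ¬ o ⋖ c := by
  intro hoc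
  have hac : a ≠ c := by
    rintro rfl
    exact (hL.iff_not (hL.incomp hab).1 (hL.incomp hab).2).1 hab hbc
  have hne : ∀ {u v : K}, o ⋖ u → o ⋖ v → u ≠ v → u ⊓ v = o ∧ u ⋖ u ⊔ v := by
    intro u v hu hv huv
    have h : u ⊓ v = o := by
      refine (hu.wcovBy.eq_or_eq (le_inf hu.le hv.le) inf_le_left).resolve_right fun h => ?_
      rcases hv.wcovBy.eq_or_eq hu.le (inf_eq_left.1 h) with h | h
      exacts [hu.lt.ne h.symm, huv h]
    exact ⟨h, covBy_sup_of_inf_covBy_right (h.symm ▸ hv)⟩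
  have hle := hL.le_sup_of_between hab hbc
  obtain ⟨hab₁, hab₂⟩ := hne hoa hob fun h => (hL.incomp hab).1 h.le
  obtain ⟨hcb₁, hcb₂⟩ := hne hoc hob fun h => (hL.incomp hbc).2 h.le
  obtain ⟨hac₁, hac₂⟩ := hne hoa hoc hac
  obtain ⟨-, hca₂⟩ := hne hoc hoa hac.symm
  have hs₁ : a ⊔ b = a ⊔ c :=
    (hac₂.wcovBy.eq_or_eq hab₂.le (sup_le le_sup_left hle)).resolve_left hab₂.lt.ne'
  have hs₂ : c ⊔ b = c ⊔ a :=
    (hca₂.wcovBy.eq_or_eq hcb₂.le (sup_le le_sup_left (sup_comm a c ▸ hle))).resolve_left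
      hcb₂.lt.ne'
  refine hslim ⟨o, a, b, c, a ⊔ c, ⟨hoa.lt, hac₂.lt⟩, ⟨hob.lt, ?_⟩,
    ⟨hoc.lt, sup_comm c a ▸ hca₂.lt⟩, ⟨hab₁, hac₁, inf_comm c b ▸ hcb₁⟩,
    ⟨hs₁, rfl, by rw [sup_comm b, hs₂, sup_comm]⟩⟩
  exact lt_of_le_of_ne hle fun h => (hL.incomp hab).1 (h ▸ le_sup_left)

/-- In a slim semimodular lattice, a join-irreducible element `b` has no element to its left or no
element to its right. Otherwise the lower cover of `b` would have an upper cover on both sides of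
`b`. -/
theorem forall_not_or_forall_not [Finite K] [IsUpperModularLattice K] (hL : IsLeftOf L)
    (hslim : ¬ HasM3Sublattice K) {b : K} (hb : SupIrred b) : (∀ y, ¬ L y b) ∨ ∀ y, ¬ L b y := by
  by_contra! ⟨⟨a, hab⟩, ⟨c, hbc⟩⟩
  obtain ⟨o, hob, ho⟩ := hb.exists_covBy
  obtain ⟨a', hoa, hab'⟩ := hL.exists_covBy_left hab hob
    (ho _ (inf_lt_right.2 (hL.incomp hab).2))
  obtain ⟨c', hoc, hbc'⟩ := hL.flip.exists_covBy_left hbc hob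
    (ho _ (inf_lt_right.2 (hL.incomp hbc).1))
  exact hL.not_covBy_of_between hslim hab' hbc' hoa hob hoc

/-- The leftmost elements form a maximal chain: each of them but the top has an upper cover in the
chain, the leftmost one of its upper covers. -/
theorem exists_covBy_leftmost [Finite K] [IsUpperModularLattice K] (hL : IsLeftOf L)
    (hslim : ¬ HasM3Sublattice K) {c x : K} (hc : ∀ y, ¬ L y c) (hx : c < x) :
    ∃ u, c ⋖ u ∧ ∀ y, ¬ L y u := by
  have hfirst : ∃ u, c ⋖ u ∧ ∀ v, c ⋖ v → ¬ L v u := by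
    obtain ⟨u, hu, -⟩ := exists_covBy_le_of_lt hx
    by_cases h : ∃ v, c ⋖ v ∧ L v u
    · obtain ⟨v, hv, hvu⟩ := h
      exact ⟨v, hv, fun w hw hwv => hL.not_covBy_of_between hslim hwv hvu hw hv hu⟩
    · push Not at h
      exact ⟨u, hu, h⟩
  obtain ⟨u, hu, hmin⟩ := hfirst
  refine ⟨u, hu, fun y hyu => ?_⟩
  have hinc := hL.incomp hyu
  by_cases hcy : c ≤ y
  · -- A cover of `c` below `y` would also be to the left of `u`.
    have hlt : c < y := lt_of_le_of_ne hcy (by rintro rfl; exact hinc.1 hu.le)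
    obtain ⟨v, hv, hvy⟩ := exists_covBy_le_of_lt hlt
    have huv : ¬ u ≤ v := fun h => hinc.2 (h.trans hvy)
    have hvu : ¬ v ≤ u := fun h =>
      (hu.wcovBy.eq_or_eq hv.le h).elim hv.lt.ne' fun h => huv h.ge
    exact hmin v hv (hL.move hyu (.inr hvy) hvu huv)
  · have hyc : ¬ y ≤ c := fun h => hinc.1 (h.trans hu.le)
    have hcL : L c y := (hL.iff_not hcy hyc).2 (hc y)
    exact (hL.iff_not hinc.1 hinc.2).1 hyu (hL.move hcL (.inl hu.le) hinc.2 hinc.1)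

/-- The number of leftmost elements below `x`, that is, the height in the left boundary chain of the
largest leftmost element below `x`. -/
noncomputable def leftCoord (L : K → K → Prop) (x : K) : ℕ :=
  {c : K | (∀ y, ¬ L y c) ∧ c ≤ x}.ncard

theorem leftmost_total (hL : IsLeftOf L) {c d : K} (hc : ∀ y, ¬ L y c) (hd : ∀ y, ¬ L y d) :
    c ≤ d ∨ d ≤ c := by
  by_contra! h
  exact hd c ((hL.iff_not h.1 h.2).2 (hc d))

variable [Finite K]

/-- The leftmost elements below `x` form an initial segment of the chain of leftmost elements, so
that comparing their numbers amounts to comparing the sets. -/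
theorem leftCoord_le_iff (hL : IsLeftOf L) {x y : K} :
    leftCoord L x ≤ leftCoord L y ↔ ∀ c, (∀ z, ¬ L z c) → c ≤ x → c ≤ y := by
  refine ⟨fun h c hc hcx => ?_, fun h =>
    Set.ncard_le_ncard (fun c hc => ⟨hc.1, h c hc.1 hc.2⟩) (Set.toFinite _)⟩
  by_contra hcy
  refine h.not_gt (Set.ncard_lt_ncard ⟨fun d hd => ⟨hd.1, ?_⟩, fun hsub => ?_⟩ (Set.toFinite _))
  · exact ((hL.leftmost_total hd.1 hc).resolve_right fun h => hcy (h.trans hd.2)).trans hcx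
  · exact hcy (hsub ⟨hc, hcx⟩).2

theorem leftCoord_mono (hL : IsLeftOf L) {x y : K} (h : x ≤ y) : leftCoord L x ≤ leftCoord L y :=
  hL.leftCoord_le_iff.2 fun _ _ hc => hc.trans h

theorem leftCoord_inf (hL : IsLeftOf L) (x y : K) :
    leftCoord L (x ⊓ y) = min (leftCoord L x) (leftCoord L y) := by
  rcases le_total (leftCoord L x) (leftCoord L y) with h | h
  · rw [min_eq_left h]
    exact le_antisymm (hL.leftCoord_mono inf_le_left)
      (hL.leftCoord_le_iff.2 fun c hc hcx => le_inf hcx (hL.leftCoord_le_iff.1 h c hc hcx))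
  · rw [min_eq_right h]
    exact le_antisymm (hL.leftCoord_mono inf_le_right)
      (hL.leftCoord_le_iff.2 fun c hc hcx => le_inf (hL.leftCoord_le_iff.1 h c hc hcx) hcx)

/-- The left and the right coordinate embed a slim semimodular lattice into a product of two
chains. -/
theorem le_iff_coord [IsUpperModularLattice K] (hL : IsLeftOf L) (hslim : ¬ HasM3Sublattice K)
    {x y : K} : x ≤ y ↔ leftCoord L x ≤ leftCoord L y ∧
      leftCoord (fun a b => L b a) x ≤ leftCoord (fun a b => L b a) y := by
  refine ⟨fun h => ⟨hL.leftCoord_mono h, hL.flip.leftCoord_mono h⟩, fun ⟨h₁, h₂⟩ => ?_⟩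
  by_contra h
  obtain ⟨j, hj, hjx, hjy⟩ := exists_supIrred_of_not_le h
  rcases hL.forall_not_or_forall_not hslim hj with hj | hj
  · exact hjy (hL.leftCoord_le_iff.1 h₁ j hj hjx)
  · exact hjy (hL.flip.leftCoord_le_iff.1 h₂ j hj hjx)

/-- Distinct meet-irreducible elements have distinct left coordinates. Elements `m` and `n` with
equal left coordinates are comparable, say `m < n`. Let `c` be the largest leftmost element below
both, and let `u` be the leftmost element that covers it. Then `m ⊔ u` covers `m` by semimodularity,
so it is the unique cover of `m` and `u ≤ n`, contrary to the choice of `c`. -/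
theorem leftCoord_injOn [IsUpperModularLattice K] (hL : IsLeftOf L) (hslim : ¬ HasM3Sublattice K) :
    Set.InjOn (leftCoord L) {m : K | InfIrred m} := by
  have key : ∀ m n : K, InfIrred m → m ≤ n → leftCoord L n ≤ leftCoord L m → m = n := by
    intro m n hm hmn h
    by_contra hne
    have hlt : m < n := lt_of_le_of_ne hmn hne
    obtain ⟨m', hmm', hm'⟩ := hm.exists_covBy
    obtain ⟨o, -, ho⟩ := (Set.finite_univ (α := K)).exists_minimal ⟨m, trivial⟩
    have hbot : ∀ x, o ≤ x := fun x => (ho trivial inf_le_left).trans inf_le_right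
    obtain ⟨c, ⟨hc, hcm⟩, hcmax⟩ := (Set.toFinite {c : K | (∀ y, ¬ L y c) ∧ c ≤ m}).exists_maximal
      ⟨o, fun y hy => (hL.incomp hy).2 (hbot y), hbot m⟩
    obtain ⟨u, hcu, hu⟩ := hL.exists_covBy_leftmost hslim hc (hcm.trans_lt hlt)
    have hum : ¬ u ≤ m := fun h => hcu.lt.not_ge (hcmax ⟨hu, h⟩ hcu.le)
    have hinf : u ⊓ m = c := (hcu.wcovBy.eq_or_eq (le_inf hcu.le hcm) inf_le_left).resolve_right
      fun h => hum (inf_eq_left.1 h)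
    have hcov : m ⋖ u ⊔ m := covBy_sup_of_inf_covBy_left (hinf.symm ▸ hcu)
    have hsup : m' = u ⊔ m := (hcov.wcovBy.eq_or_eq hmm'.le (hm' _ hcov.lt)).resolve_left
      hmm'.lt.ne'
    have hun : u ≤ n := le_sup_left.trans (hsup ▸ hm' n hlt)
    exact hum (hL.leftCoord_le_iff.1 h u hu hun)
  intro m hm n hn h
  have hcomp := le_total (leftCoord (fun a b => L b a) m) (leftCoord (fun a b => L b a) n)
  rcases hcomp with h' | h'
  · exact key m n hm ((hL.le_iff_coord hslim).2 ⟨h.le, h'⟩) h.ge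
  · exact (key n m hn ((hL.le_iff_coord hslim).2 ⟨h.ge, h'⟩) h.le).symm

end IsLeftOf

/-! ### Coordinates and congruences -/

/-- Coordinates of a lattice in a product of two chains that are compatible with meets and are
injective on the meet-irreducible elements. They place the meet-irreducible elements in the plane
like the points of a permutation diagram. -/
structure IsCoordPair {K : Type*} [Lattice K] (l r : K → ℕ) : Prop where
  le_iff : ∀ x y, x ≤ y ↔ l x ≤ l y ∧ r x ≤ r y
  map_inf_left : ∀ x y, l (x ⊓ y) = min (l x) (l y)
  map_inf_right : ∀ x y, r (x ⊓ y) = min (r x) (r y)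
  injOn_left : ∀ m n, InfIrred m → InfIrred n → l m = l n → m = n
  injOn_right : ∀ m n, InfIrred m → InfIrred n → r m = r n → m = n

/-- A meet-irreducible element `m` is collapsed by a congruence if `m` is congruent to a larger
element, equivalently to its upper cover. -/
def LatticeCon.Collapses {K : Type*} [Lattice K] (θ : LatticeCon K) (m : K) : Prop :=
  InfIrred m ∧ ∃ x, m < x ∧ θ.r m x

/-- Some meet-irreducible element has a smaller `l`-coordinate and a larger `r`-coordinate than
`e`. -/
def HasUpperLeft {K : Type*} [Lattice K] (l r : K → ℕ) (e : K) : Prop :=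
  ∃ h, InfIrred h ∧ l h < l e ∧ r e < r h

/-- A configuration in which the collapse of `f` implies the collapse of `e`: the point `f` is to the
lower right of `e`, a point is to the upper left of `e`, and no point to the upper right of `f` is
as low as `e`. -/
structure Step {K : Type*} [Lattice K] (l r : K → ℕ) (f e : K) : Prop where
  infIrred_left : InfIrred f
  infIrred_right : InfIrred e
  left_lt : l e < l f
  right_lt : r f < r e
  hasUpperLeft : HasUpperLeft l r e
  lt_of_lt : ∀ g, InfIrred g → l f < l g → r f < r g → r e < r g

/-- The configuration of `Step`, or its mirror image. -/
def Forces {K : Type*} [Lattice K] (l r : K → ℕ) (f e : K) : Prop :=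
  Step l r f e ∨ Step r l f e

theorem forces_swap {K : Type*} [Lattice K] (l r : K → ℕ) : Forces r l = Forces l r := by
  ext f e
  exact or_comm

theorem Forces.hasUpperLeft {K : Type*} [Lattice K] {l r : K → ℕ} {f e : K} (h : Forces l r f e) :
    HasUpperLeft l r e := by
  rcases h with h | h
  exacts [h.hasUpperLeft, ⟨f, h.infIrred_left, h.right_lt, h.left_lt⟩]

theorem Forces.infIrred {K : Type*} [Lattice K] {l r : K → ℕ} {f e : K} (h : Forces l r f e) :
    InfIrred e := by
  rcases h with h | h
  exacts [h.infIrred_right, h.infIrred_right]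

theorem Forces.ne {K : Type*} [Lattice K] {l r : K → ℕ} {f e : K} (h : Forces l r f e) :
    e ≠ f := by
  rintro rfl
  rcases h with h | h
  exacts [h.left_lt.false, h.left_lt.false]

/-- A congruence is determined by the meet-irreducible elements that it collapses. -/
theorem LatticeCon.le_iff_collapses {K : Type*} [Lattice K] [Finite K] {θ φ : LatticeCon K} :
    θ ≤ φ ↔ ∀ m, θ.Collapses m → φ.Collapses m := by
  refine ⟨fun h m ⟨hm, x, hx, hθ⟩ => ⟨hm, x, hx, h m x hθ⟩, fun h => ?_⟩
  have key : ∀ x y, θ.r x y → φ.r y (x ⊔ y) := by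
    intro x y hxy
    by_contra hφ
    -- The set below contains the largest element that `φ` identifies with `y`; a maximal element of
    -- the set is meet-irreducible, and it is collapsed by `θ` but not by `φ`.
    let T : Set K := {u | y ≤ u ∧ ¬ x ≤ u ∧ ∀ v, u ≤ v → φ.r u v → v = u}
    -- Every element lies below the largest element of its congruence class.
    have htop : ∀ a, ∃ b, a ≤ b ∧ φ.r a b ∧ ∀ v, b ≤ v → φ.r b v → v = b := by
      intro a
      obtain ⟨b, ⟨hab, hb⟩, hmax⟩ := (Set.toFinite {b : K | a ≤ b ∧ φ.r a b}).exists_maximal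
        ⟨a, le_rfl, φ.iseqv.refl a⟩
      exact ⟨b, hab, hb, fun v hbv hv =>
        le_antisymm (hmax ⟨hab.trans hbv, φ.iseqv.trans hb hv⟩ hbv) hbv⟩
    have hT : T.Nonempty := by
      obtain ⟨b, hyb, hb, hmax⟩ := htop y
      refine ⟨b, hyb, fun hxb => hφ ?_, hmax⟩
      have h := φ.inf hb (φ.iseqv.refl (x ⊔ y))
      rw [inf_eq_left.2 le_sup_right, inf_eq_right.2 (sup_le hxb hyb)] at h
      exact h
    obtain ⟨u, ⟨hyu, hxu, hu⟩, humax⟩ := (Set.toFinite T).exists_maximal hT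
    have hgt : ∀ v, u ≤ v → v ≠ u → ∃ w, v ≤ w ∧ φ.r v w ∧ x ≤ w := by
      intro v huv hne
      obtain ⟨w, hvw, hw, hmax⟩ := htop v
      refine ⟨w, hvw, hw, by_contra fun hxw => hne ?_⟩
      exact le_antisymm (hvw.trans (humax ⟨hyu.trans (huv.trans hvw), hxw, hmax⟩ (huv.trans hvw)))
        huv
    have hirr : InfIrred u := by
      refine ⟨fun hmax => hxu (le_sup_right.trans (hmax le_sup_left)), fun b c hbc => ?_⟩
      by_contra! hne
      obtain ⟨b', hb, hb', hxb⟩ := hgt b (hbc ▸ inf_le_left) hne.1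
      obtain ⟨c', hc, hc', hxc⟩ := hgt c (hbc ▸ inf_le_right) hne.2
      have := hu (b' ⊓ c') (hbc ▸ inf_le_inf hb hc) (hbc ▸ φ.inf hb' hc')
      exact hxu (this ▸ le_inf hxb hxc)
    have hθ : θ.r u (x ⊔ u) := by
      have h := θ.sup (θ.iseqv.symm hxy) (θ.iseqv.refl u)
      rwa [sup_eq_right.2 hyu] at h
    have hlt : u < x ⊔ u := right_lt_sup.2 hxu
    obtain ⟨-, v, huv, hv⟩ := h u ⟨hirr, _, hlt, hθ⟩
    exact huv.ne' (hu v huv.le hv)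
  intro x y hxy
  refine φ.iseqv.trans ?_ (φ.iseqv.symm (key x y hxy))
  rw [sup_comm]
  exact key y x (θ.iseqv.symm hxy)

namespace IsCoordPair

variable {K : Type*} [Lattice K] {l r : K → ℕ}

theorem swap (hc : IsCoordPair l r) : IsCoordPair r l where
  le_iff x y := (hc.le_iff x y).trans and_comm
  map_inf_left := hc.map_inf_right
  map_inf_right := hc.map_inf_left
  injOn_left := hc.injOn_right
  injOn_right := hc.injOn_left

variable [Finite K]

/-- An element with a small right coordinate is below a meet-irreducible element with a small right
coordinate. -/
theorem exists_infIrred_right_le (hc : IsCoordPair l r) {x y : K} {t : ℕ} (hx : r x ≤ t)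
    (hy : t < r y) : ∃ n, InfIrred n ∧ x ≤ n ∧ r n ≤ t ∧ ∀ u, n < u → t < r u := by
  obtain ⟨n, ⟨hxn, hn⟩, hmax⟩ := (Set.toFinite {u : K | x ≤ u ∧ r u ≤ t}).exists_maximal
    ⟨x, le_rfl, hx⟩
  have hgt : ∀ u, n < u → t < r u := fun u hu => by
    by_contra! h
    exact hu.not_ge (hmax ⟨hxn.trans hu.le, h⟩ hu.le)
  refine ⟨n, ⟨fun h => ?_, fun b c hbc => ?_⟩, hxn, hn, hgt⟩
  · have := ((hc.le_iff y n).1 (le_sup_right.trans (h le_sup_left))).2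
    omega
  · by_contra! hne
    have hb := hgt b (lt_of_le_of_ne (hbc ▸ inf_le_left) hne.1.symm)
    have hc' := hgt c (lt_of_le_of_ne (hbc ▸ inf_le_right) hne.2.symm)
    have := hc.map_inf_right b c
    rw [hbc] at this
    omega

/-- If a congruence collapses `f` by identifying it with `y > f`, then meeting with a point `x` to
the upper left of `e` and joining with `e` identifies `e` with a larger element. -/
theorem collapses_of_step (hc : IsCoordPair l r) {θ : LatticeCon K} {f e : K} (h : Step l r f e)
    (hf : θ.Collapses f) : θ.Collapses e := by
  obtain ⟨-, y, hfy, hθ⟩ := hf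
  obtain ⟨x, hx, hxl, hxr⟩ := h.hasUpperLeft
  have hle : f ⊓ x ≤ e := by
    rw [hc.le_iff, hc.map_inf_left, hc.map_inf_right]
    have := h.right_lt
    omega
  have hyr : r e < r y := by
    by_contra! hye
    obtain ⟨g, hg, hyg, hge, -⟩ := hc.exists_infIrred_right_le hye hxr
    have hfg := (hc.le_iff f g).1 (hfy.le.trans hyg)
    have hne : f ≠ g := (hfy.trans_le hyg).ne
    have h₁ : l f ≠ l g := fun h' => hne (hc.injOn_left _ _ h.infIrred_left hg h')
    have h₂ : r f ≠ r g := fun h' => hne (hc.injOn_right _ _ h.infIrred_left hg h')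
    have := h.lt_of_lt g hg (by omega) (by omega)
    omega
  have hnle : ¬ y ⊓ x ≤ e := by
    rw [hc.le_iff, hc.map_inf_right]
    omega
  refine ⟨h.infIrred_right, _, left_lt_sup.2 hnle, ?_⟩
  have := θ.sup (θ.iseqv.refl e) (θ.inf hθ (θ.iseqv.refl x))
  rwa [sup_eq_left.2 hle] at this

theorem collapses_of_forces (hc : IsCoordPair l r) {θ : LatticeCon K} {f e : K}
    (h : Forces l r f e) (hf : θ.Collapses f) : θ.Collapses e :=
  h.elim (fun h => hc.collapses_of_step h hf) fun h => hc.swap.collapses_of_step h hf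

theorem collapses_of_reflTransGen (hc : IsCoordPair l r) {θ : LatticeCon K} {f e : K}
    (h : Relation.ReflTransGen (Forces l r) f e) (hf : θ.Collapses f) : θ.Collapses e := by
  induction h with
  | refl => exact hf
  | tail _ h ih => exact hc.collapses_of_forces h ih

/-- Let `S` be closed under `Step`, and let `x` and `y` lie below the same meet-irreducible elements
outside `S`. If `x ⊓ z ≤ m` but `y ⊓ z` is higher than `m`, then a maximal element above `x` that is
not higher than `m` belongs to `S` and forces `m`. -/
theorem mem_of_inf_le (hc : IsCoordPair l r) {S : Set K}
    (hS : ∀ f e, Step l r f e → f ∈ S → e ∈ S) {x y z m : K}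
    (hxy : ∀ n, InfIrred n → n ∉ S → (x ≤ n ↔ y ≤ n)) (hm : InfIrred m) (hle : x ⊓ z ≤ m)
    (hlt : r m < r (y ⊓ z)) : m ∈ S := by
  by_contra hmS
  rw [hc.map_inf_right] at hlt
  rw [hc.le_iff, hc.map_inf_left, hc.map_inf_right] at hle
  have hxm : ¬ x ≤ m := fun h => by
    have := ((hc.le_iff y m).1 ((hxy m hm hmS).1 h)).2
    omega
  rw [hc.le_iff] at hxm
  obtain ⟨n, hn, hxn, hnm, hmax⟩ := hc.exists_infIrred_right_le (x := x) (y := y) (t := r m)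
    (by omega) (by omega)
  obtain ⟨k, hk, hzk, hkm, -⟩ := hc.swap.exists_infIrred_right_le (x := z) (y := x) (t := l m)
    (by omega) (by omega)
  have hnS : n ∈ S := by
    by_contra hnS
    have := ((hc.le_iff y n).1 ((hxy n hn hnS).1 hxn)).2
    omega
  rw [hc.le_iff] at hxn hzk
  have h₁ : r n ≠ r m := fun h => by
    obtain rfl := hc.injOn_right _ _ hn hm h
    omega
  have h₂ : l k ≠ l m := fun h => by
    obtain rfl := hc.injOn_left _ _ hk hm h
    omega
  refine hmS (hS n m ⟨hn, hm, by omega, by omega, ⟨k, hk, by omega, by omega⟩, ?_⟩ hnS)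
  intro g _ hlg hrg
  refine hmax g (lt_of_le_of_ne ((hc.le_iff n g).2 ⟨hlg.le, hrg.le⟩) ?_)
  rintro rfl
  omega

/-- The sets of meet-irreducible elements that are closed under `Forces` are the sets of elements
collapsed by a congruence. -/
theorem exists_collapses_iff (hc : IsCoordPair l r) {S : Set K} (hirr : ∀ m ∈ S, InfIrred m)
    (hS : ∀ f e, Forces l r f e → f ∈ S → e ∈ S) :
    ∃ θ : LatticeCon K, ∀ m, θ.Collapses m ↔ m ∈ S := by
  let R : K → K → Prop := fun x y => ∀ m, InfIrred m → m ∉ S → (x ≤ m ↔ y ≤ m)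
  have hsymm : ∀ {x y}, R x y → R y x := fun h m hm hmS => (h m hm hmS).symm
  have htrans : ∀ {x y z}, R x y → R y z → R x z := fun h₁ h₂ m hm hmS =>
    (h₁ m hm hmS).trans (h₂ m hm hmS)
  have hone : ∀ {x y z m}, R x y → InfIrred m → m ∉ S → x ⊓ z ≤ m → y ⊓ z ≤ m := by
    intro x y z m h hm hmS hle
    refine (hc.le_iff _ _).2 ⟨?_, ?_⟩
    · by_contra! hlt
      exact hmS (hc.swap.mem_of_inf_le (fun f e hs => hS f e (.inr hs)) h hm hle hlt)
    · by_contra! hlt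
      exact hmS (hc.mem_of_inf_le (fun f e hs => hS f e (.inl hs)) h hm hle hlt)
  have hinf : ∀ {x y} z, R x y → R (x ⊓ z) (y ⊓ z) := fun z h m hm hmS =>
    ⟨hone h hm hmS, hone (hsymm h) hm hmS⟩
  let θ : LatticeCon K :=
    { r := R
      iseqv := ⟨fun _ _ _ _ => Iff.rfl, hsymm, htrans⟩
      inf := fun {w x y z} h₁ h₂ => by
        refine htrans (hinf y h₁) ?_
        rw [inf_comm x y, inf_comm x z]
        exact hinf x h₂
      sup := fun h₁ h₂ m hm hmS => by
        rw [sup_le_iff, sup_le_iff, h₁ m hm hmS, h₂ m hm hmS] }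
  refine ⟨θ, fun m => ⟨fun ⟨hm, x, hx, hθ⟩ => ?_, fun hmS => ?_⟩⟩
  · by_contra hmS
    exact hx.not_ge ((hθ m hm hmS).1 le_rfl)
  · obtain ⟨m', hmm', hm'⟩ := (hirr m hmS).exists_covBy
    refine ⟨hirr m hmS, m', hmm'.lt, fun n hn hnS => ⟨fun h => hm' n ?_, hmm'.le.trans⟩⟩
    exact lt_of_le_of_ne h (by rintro rfl; exact hnS hmS)

end IsCoordPair

/-! ### Join-irreducible congruences -/

/-- `θ` is the least congruence that collapses the meet-irreducible element `m`, described by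
the set of elements that it collapses. -/
def IsGen {K : Type*} [Lattice K] (l r : K → ℕ) (θ : LatticeCon K) (m : K) : Prop :=
  InfIrred m ∧ ∀ e, θ.Collapses e ↔ Relation.ReflTransGen (Forces l r) m e

theorem IsGen.swap {K : Type*} [Lattice K] {l r : K → ℕ} {θ : LatticeCon K} {m : K}
    (h : IsGen l r θ m) : IsGen r l θ m := by
  rwa [IsGen, forces_swap]

namespace IsCoordPair

variable {K : Type*} [Lattice K] [Finite K] {l r : K → ℕ}

theorem exists_isGen (hc : IsCoordPair l r) {m : K} (hm : InfIrred m) :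
    ∃ θ : LatticeCon K, IsGen l r θ m := by
  obtain ⟨θ, hθ⟩ := hc.exists_collapses_iff (S := {e | Relation.ReflTransGen (Forces l r) m e})
    (fun e he => by
      rcases Relation.ReflTransGen.cases_tail he with rfl | ⟨f, -, hf⟩
      exacts [hm, hf.infIrred])
    (fun f e h hf => hf.tail h)
  exact ⟨θ, hm, hθ⟩

theorem isGen_le_iff (hc : IsCoordPair l r) {θ φ : LatticeCon K} {m : K} (h : IsGen l r θ m) :
    θ ≤ φ ↔ φ.Collapses m :=
  ⟨fun hle => LatticeCon.le_iff_collapses.1 hle m ((h.2 m).2 .refl), fun hφ =>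
    LatticeCon.le_iff_collapses.2 fun e he => hc.collapses_of_reflTransGen ((h.2 e).1 he) hφ⟩

theorem isGen_le_isGen_iff (hc : IsCoordPair l r) {θ φ : LatticeCon K} {m n : K}
    (h : IsGen l r θ m) (h' : IsGen l r φ n) :
    θ ≤ φ ↔ Relation.ReflTransGen (Forces l r) n m :=
  (hc.isGen_le_iff h).trans (h'.2 m)

theorem supIrred_of_isGen (hc : IsCoordPair l r) {θ : LatticeCon K} {m : K}
    (h : IsGen l r θ m) : SupIrred θ := by
  refine ⟨fun hmin => ?_, fun φ ψ hsup => ?_⟩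
  · obtain ⟨ω, hω⟩ := hc.exists_collapses_iff (S := ∅) (by simp) (by simp)
    have hle : ω ≤ θ := LatticeCon.le_iff_collapses.2 fun e he => ((hω e).1 he).elim
    exact (hω m).1 ((hc.isGen_le_iff h).1 (hmin hle))
  · obtain ⟨χ, hχ⟩ := hc.exists_collapses_iff (S := {e | φ.Collapses e ∨ ψ.Collapses e})
      (fun e he => he.elim And.left And.left)
      (fun f e hfe hf => hf.imp (hc.collapses_of_forces hfe) (hc.collapses_of_forces hfe))
    have hle : θ ≤ χ := hsup ▸ sup_le
      (LatticeCon.le_iff_collapses.2 fun e he => (hχ e).2 (.inl he))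
      (LatticeCon.le_iff_collapses.2 fun e he => (hχ e).2 (.inr he))
    refine ((hχ m).1 ((hc.isGen_le_iff h).1 hle)).imp (fun hm => ?_) fun hm => ?_
    · exact le_antisymm (hsup ▸ le_sup_left) ((hc.isGen_le_iff h).2 hm)
    · exact le_antisymm (hsup ▸ le_sup_right) ((hc.isGen_le_iff h).2 hm)

theorem exists_isGen_of_supIrred (hc : IsCoordPair l r) {θ : LatticeCon K} (h : SupIrred θ) :
    ∃ m, IsGen l r θ m := by
  classical
  have := Fintype.ofFinite K
  have hex : ∀ m : K, ∃ φ : LatticeCon K, InfIrred m → IsGen l r φ m := fun m => by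
    by_cases hm : InfIrred m
    · obtain ⟨φ, hφ⟩ := hc.exists_isGen hm
      exact ⟨φ, fun _ => hφ⟩
    · exact ⟨θ, fun h => (hm h).elim⟩
  choose g hg using hex
  obtain ⟨m, hm, rfl⟩ := h.finset_sup_eq (s := Finset.univ.filter θ.Collapses) (f := g) (by
    refine le_antisymm (Finset.sup_le fun m hm => ?_) (LatticeCon.le_iff_collapses.2 fun m hm => ?_)
    · have hm := (Finset.mem_filter.1 hm).2
      exact (hc.isGen_le_iff (hg m hm.1)).2 hm
    · exact (hc.isGen_le_iff (hg m hm.1)).1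
        (Finset.le_sup (f := g) (Finset.mem_filter.2 ⟨Finset.mem_univ m, hm⟩)))
  exact ⟨m, hg m (Finset.mem_filter.1 hm).2.1⟩

/-! ### Maximal join-irreducible congruences and their lower covers -/

/-- If `e` has a point to the lower right, then the rightmost point lower than `e` is a boundary
point, and together with a point to the upper left of `e` it forces `e`. -/
theorem exists_forces_of_hasUpperLeft (hc : IsCoordPair l r) {e : K} (he : InfIrred e)
    (h₁ : HasUpperLeft l r e) (h₂ : HasUpperLeft r l e) :
    ∃ f, InfIrred f ∧ Forces l r f e ∧ ¬ HasUpperLeft r l f := by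
  obtain ⟨h, hh, hhr, hhl⟩ := h₂
  obtain ⟨f, ⟨hf, hfr⟩, hmax⟩ := (Set.toFinite {f : K | InfIrred f ∧ r f < r e}).exists_maximalFor l
    _ ⟨h, hh, hhr⟩
  have hmax' : ∀ g, InfIrred g → r g < r e → l g ≤ l f := fun g hg hgr => by
    by_contra! hlt
    exact hlt.not_ge (hmax ⟨hg, hgr⟩ hlt.le)
  refine ⟨f, hf, .inl ⟨hf, he, hhl.trans_le (hmax' h hh hhr), hfr, h₁, fun g hg hgl hgr => ?_⟩, ?_⟩
  · by_contra! hle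
    rcases hle.lt_or_eq with hlt | heq
    · exact (hmax' g hg hlt).not_gt hgl
    · obtain rfl := hc.injOn_right _ _ hg he heq
      have := hmax' h hh hhr
      omega
  · rintro ⟨g, hg, hgr, hgl⟩
    exact (hmax' g hg (hgr.trans hfr)).not_gt hgl

/-- The maximal join-irreducible congruences are those generated by boundary points. -/
theorem isMax_iff (hc : IsCoordPair l r) {x : JoinIrredCon K} {m : K} (hx : IsGen l r x.1 m) :
    IsMax x ↔ ¬ HasUpperLeft l r m ∨ ¬ HasUpperLeft r l m := by
  refine ⟨fun hmax => ?_, fun h y hxy => ?_⟩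
  · by_contra! h
    obtain ⟨f, hf, hfm, hfr⟩ := hc.exists_forces_of_hasUpperLeft hx.1 h.1 h.2
    obtain ⟨φ, hφ⟩ := hc.exists_isGen hf
    have hle : x ≤ ⟨φ, hc.supIrred_of_isGen hφ⟩ := (hc.isGen_le_isGen_iff hx hφ).2 (.single hfm)
    have hge := (hc.isGen_le_isGen_iff hφ hx).1 (hmax hle)
    rcases Relation.ReflTransGen.cases_tail hge with rfl | ⟨g, -, hg⟩
    · exact hfr h.2
    · exact hfr (by rw [← forces_swap] at hg; exact hg.hasUpperLeft)
  · obtain ⟨n, hn⟩ := hc.exists_isGen_of_supIrred y.2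
    rcases Relation.ReflTransGen.cases_tail ((hc.isGen_le_isGen_iff hx hn).1 hxy) with
      rfl | ⟨g, -, hg⟩
    · exact (hc.isGen_le_isGen_iff hn hx).2 .refl
    · rcases h with h | h
      · exact (h hg.hasUpperLeft).elim
      · exact (h (by rw [← forces_swap] at hg; exact hg.hasUpperLeft)).elim

/-- A lower cover of a congruence generated by a boundary point is generated by a point that the
boundary point forces directly. -/
theorem exists_forces_of_covBy (hc : IsCoordPair l r) {x z : JoinIrredCon K} {m : K}
    (hx : IsGen l r x.1 m) (hm : ¬ HasUpperLeft l r m) (hzx : z ⋖ x) :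
    ∃ e, Forces l r m e ∧ IsGen l r z.1 e := by
  obtain ⟨e₀, he₀⟩ := hc.exists_isGen_of_supIrred z.2
  have hme := (hc.isGen_le_isGen_iff he₀ hx).1 hzx.le
  rcases Relation.ReflTransGen.cases_head hme with rfl | ⟨e, hme, hee⟩
  · exact (hzx.lt.not_ge ((hc.isGen_le_isGen_iff hx he₀).2 .refl)).elim
  obtain ⟨φ, hφ⟩ := hc.exists_isGen hme.infIrred
  let w : JoinIrredCon K := ⟨φ, hc.supIrred_of_isGen hφ⟩
  have hzw : z ≤ w := (hc.isGen_le_isGen_iff he₀ hφ).2 hee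
  have hwx : w ≤ x := (hc.isGen_le_isGen_iff hφ hx).2 (.single hme)
  rcases hzx.wcovBy.eq_or_eq hzw hwx with h | h
  · exact ⟨e, hme, h ▸ hφ⟩
  · have hem := (hc.isGen_le_isGen_iff hx hφ).1 h.ge
    rcases Relation.ReflTransGen.cases_tail hem with h | ⟨g, -, hg⟩
    · exact (hme.ne h.symm).elim
    · exact (hm hg.hasUpperLeft).elim

omit [Finite K] in
/-- Along `Forces`, starting from a point that is not on the upper left boundary, the largest height
of the points further to the left does not increase. -/
theorem exists_right_le_of_reflTransGen (hc : IsCoordPair l r) {f e : K} (hf : InfIrred f)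
    (hul : HasUpperLeft l r f) (h : Relation.ReflTransGen (Forces l r) f e) :
    ∀ g, InfIrred g → l g < l e → ∃ k, InfIrred k ∧ l k < l f ∧ r g ≤ r k := by
  induction h using Relation.ReflTransGen.head_induction_on with
  | refl => exact fun g hg hlt => ⟨g, hg, hlt, le_rfl⟩
  | @head f d hfd _ ih =>
    intro g hg hlt
    obtain ⟨k, hk, hkd, hgk⟩ := ih hfd.infIrred hfd.hasUpperLeft g hg hlt
    rcases hfd with h | h
    · exact ⟨k, hk, hkd.trans h.left_lt, hgk⟩
    · obtain ⟨i, hi, hil, hir⟩ := hul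
      rcases lt_trichotomy (l k) (l f) with hkf | hkf | hkf
      · exact ⟨k, hk, hkf, hgk⟩
      · obtain rfl := hc.injOn_left _ _ hk hf hkf
        exact ⟨i, hi, hil, by omega⟩
      · have : r k ≤ r f := by
          by_contra! hlt
          have := h.lt_of_lt k hk hlt hkf
          omega
        exact ⟨i, hi, hil, by omega⟩

omit [Finite K] in
/-- A point `x` on the upper left boundary that forces `e` is the highest point to the left of
`e`. -/
theorem right_le_of_forces (hc : IsCoordPair l r) {x e : K} (hul : ¬ HasUpperLeft l r x)
    (h : Forces l r x e) : l x < l e ∧ ∀ g, InfIrred g → l g < l e → r g ≤ r x := by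
  rcases h with h | h
  · exact (hul ⟨e, h.infIrred_right, h.left_lt, h.right_lt⟩).elim
  · refine ⟨h.right_lt, fun g hg hge => ?_⟩
    by_contra! hlt
    rcases lt_trichotomy (l g) (l x) with hgx | hgx | hgx
    · exact hul ⟨g, hg, hgx, hlt⟩
    · obtain rfl := hc.injOn_left _ _ hg h.infIrred_left hgx
      exact hlt.false
    · exact (h.lt_of_lt g hg hlt hgx).not_gt hge

/-- Congruences generated by two points of the upper left boundary with a common lower cover are
equal: the lower cover is generated by a point `e` forced by the one and by a point `d` forced by
the other, the points `d` and `e` force each other in several steps, and so the highest points to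
the left of `d` and of `e` coincide. -/
theorem eq_of_covBy_of_covBy (hc : IsCoordPair l r) {x y z : JoinIrredCon K} {m n : K}
    (hx : IsGen l r x.1 m) (hm : ¬ HasUpperLeft l r m) (hy : IsGen l r y.1 n)
    (hn : ¬ HasUpperLeft l r n) (hzx : z ⋖ x) (hzy : z ⋖ y) : x = y := by
  obtain ⟨e, hme, he⟩ := hc.exists_forces_of_covBy hx hm hzx
  obtain ⟨d, hnd, hd⟩ := hc.exists_forces_of_covBy hy hn hzy
  obtain ⟨hml, hmr⟩ := hc.right_le_of_forces hm hme
  obtain ⟨hnl, hnr⟩ := hc.right_le_of_forces hn hnd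
  have hed := (hc.isGen_le_isGen_iff hd he).1 le_rfl
  have hde := (hc.isGen_le_isGen_iff he hd).1 le_rfl
  obtain ⟨i, hi, hil, hir⟩ :=
    hc.exists_right_le_of_reflTransGen hd.1 hnd.hasUpperLeft hde m hx.1 hml
  obtain ⟨j, hj, hjl, hjr⟩ :=
    hc.exists_right_le_of_reflTransGen he.1 hme.hasUpperLeft hed n hy.1 hnl
  obtain rfl := hc.injOn_right _ _ hx.1 hy.1
    (le_antisymm (hir.trans (hnr i hi hil)) (hjr.trans (hmr j hj hjl)))
  exact Subtype.ext (le_antisymm ((hc.isGen_le_isGen_iff hx hy).2 .refl)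
    ((hc.isGen_le_isGen_iff hy hx).2 .refl))

/-- A lattice with at least three elements has a point on the upper left boundary and a point on the
lower right boundary that generate distinct congruences: the leftmost and the rightmost point. -/
theorem exists_boundary_ne (hc : IsCoordPair l r) (hcard : 3 ≤ Nat.card K) :
    ∃ (x y : JoinIrredCon K) (m n : K), x ≠ y ∧ IsGen l r x.1 m ∧ ¬ HasUpperLeft l r m ∧
      IsGen l r y.1 n ∧ ¬ HasUpperLeft r l n := by
  obtain ⟨a, b, ha, hb, hab⟩ : ∃ a b : K, InfIrred a ∧ InfIrred b ∧ a ≠ b := by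
    by_contra! hsub
    -- With at most one meet-irreducible element, being below one determines an element.
    have hinj : Function.Injective fun x : K => ∃ m, InfIrred m ∧ x ≤ m := by
      have key : ∀ x y : K, ((∃ m, InfIrred m ∧ y ≤ m) → ∃ m, InfIrred m ∧ x ≤ m) → x ≤ y := by
        intro x y h
        by_contra hxy
        obtain ⟨m, hm, hym, hxm⟩ := exists_infIrred_of_not_le hxy
        obtain ⟨k, hk, hxk⟩ := h ⟨m, hm, hym⟩
        exact hxm (hsub k m hk hm ▸ hxk)
      intro x y h
      have h' : (∃ m, InfIrred m ∧ x ≤ m) ↔ ∃ m, InfIrred m ∧ y ≤ m := iff_of_eq h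
      exact le_antisymm (key x y h'.2) (key y x h'.1)
    have := Nat.card_le_card_of_injective _ hinj
    rw [Nat.card_eq_fintype_card (α := Prop), Fintype.card_prop] at this
    omega
  obtain ⟨m, hm, hmin⟩ := (Set.toFinite {m : K | InfIrred m}).exists_minimalFor l _ ⟨a, ha⟩
  obtain ⟨n, hn, hmax⟩ := (Set.toFinite {m : K | InfIrred m}).exists_maximalFor l _ ⟨a, ha⟩
  have hmin' : ∀ g, InfIrred g → l m ≤ l g := fun g hg => by
    by_contra! h
    exact h.not_ge (hmin hg h.le)
  have hmax' : ∀ g, InfIrred g → l g ≤ l n := fun g hg => by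
    by_contra! h
    exact h.not_ge (hmax hg h.le)
  have hm' : ¬ HasUpperLeft l r m := fun ⟨g, hg, hgm, _⟩ => (hmin' g hg).not_gt hgm
  have hn' : ¬ HasUpperLeft r l n := fun ⟨g, hg, _, hgn⟩ => (hmax' g hg).not_gt hgn
  obtain ⟨θ, hθ⟩ := hc.exists_isGen hm
  obtain ⟨φ, hφ⟩ := hc.exists_isGen hn
  refine ⟨⟨θ, hc.supIrred_of_isGen hθ⟩, ⟨φ, hc.supIrred_of_isGen hφ⟩, m, n, fun h => ?_, hθ, hm',
    hφ, hn'⟩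
  have hmn := (hc.isGen_le_isGen_iff hφ hθ).1 (congrArg Subtype.val h).ge
  rcases Relation.ReflTransGen.cases_tail hmn with rfl | ⟨g, -, hg⟩
  · refine hab (hc.injOn_left _ _ ha hb ?_)
    have := hmin' a ha
    have := hmin' b hb
    have := hmax' a ha
    have := hmax' b hb
    omega
  · exact hn' (by rw [← forces_swap] at hg; exact hg.hasUpperLeft)

end IsCoordPair

/-! ### The partition property -/

theorem IsSPSLattice.exists_isCoordPair {K : Type*} [Lattice K] (hK : IsSPSLattice K) :
    ∃ l r : K → ℕ, IsCoordPair l r := by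
  have := hK.finite
  have := hK.semimodular
  rcases isEmpty_or_nonempty K with hempty | hne
  · exact ⟨hempty.elim, hempty.elim, ⟨fun x => hempty.elim x, fun x => hempty.elim x,
      fun x => hempty.elim x, fun x => hempty.elim x, fun x => hempty.elim x⟩⟩
  · have := Fintype.ofFinite K
    let _ : BoundedOrder K := Fintype.toBoundedOrder K
    obtain ⟨pos, hpos⟩ := hK.planar
    obtain ⟨L, hL⟩ := hpos.exists_isLeftOf
    refine ⟨IsLeftOf.leftCoord L, IsLeftOf.leftCoord fun a b => L b a, fun x y => hL.le_iff_coord hK.slim,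
      hL.leftCoord_inf, hL.flip.leftCoord_inf, fun m n hm hn h => ?_, fun m n hm hn h => ?_⟩
    · exact hL.leftCoord_injOn hK.slim hm hn h
    · exact hL.flip.leftCoord_injOn hK.slim hm hn h

theorem mainTheorem1 {K : Type*} [Lattice K] (hK : IsSPSLattice K) (hcard : 3 ≤ Nat.card K) :
    ∃ A B : Set (JoinIrredCon K),
      A.Nonempty ∧ B.Nonempty ∧ Disjoint A B ∧ A ∪ B = {x : JoinIrredCon K | IsMax x} ∧
      (∀ x ∈ A, ∀ y ∈ A, x ≠ y → ¬ ∃ z : JoinIrredCon K, z ⋖ x ∧ z ⋖ y) ∧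
      (∀ x ∈ B, ∀ y ∈ B, x ≠ y → ¬ ∃ z : JoinIrredCon K, z ⋖ x ∧ z ⋖ y) := by
  have := hK.finite
  obtain ⟨l, r, hc⟩ := hK.exists_isCoordPair
  obtain ⟨x₀, y₀, m₀, n₀, hne, hx₀, hm₀, hy₀, hn₀⟩ := hc.exists_boundary_ne hcard
  let A' : Set (JoinIrredCon K) := {x | ∃ m, IsGen l r x.1 m ∧ ¬ HasUpperLeft l r m}
  let B' : Set (JoinIrredCon K) := {x | ∃ m, IsGen l r x.1 m ∧ ¬ HasUpperLeft r l m}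
  have hAx : x₀ ∈ A' := ⟨m₀, hx₀, hm₀⟩
  have hBy : y₀ ∈ B' := ⟨n₀, hy₀, hn₀⟩
  -- A point may be on both boundaries, so the two sets have to be made disjoint.
  refine ⟨A' \ {y₀}, B' \ (A' \ {y₀}), ⟨x₀, hAx, hne⟩, ⟨y₀, hBy, fun h => h.2 rfl⟩,
    Set.disjoint_sdiff_right, ?_, ?_, ?_⟩
  · rw [Set.union_sdiff_self]
    ext x
    obtain ⟨m, hm⟩ := hc.exists_isGen_of_supIrred x.2
    rw [Set.mem_ofPred_eq]
    constructor
    · rintro (⟨⟨m, hm, h⟩, -⟩ | ⟨m, hm, h⟩)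
      exacts [(hc.isMax_iff hm).2 (.inl h), (hc.isMax_iff hm).2 (.inr h)]
    · intro hmax
      by_cases hxy : x = y₀
      · exact .inr (hxy ▸ hBy)
      · exact ((hc.isMax_iff hm).1 hmax).imp (fun h => ⟨⟨m, hm, h⟩, hxy⟩) fun h => ⟨m, hm, h⟩
  · rintro x ⟨⟨m, hm, hm'⟩, -⟩ y ⟨⟨n, hn, hn'⟩, -⟩ hxy ⟨z, hzx, hzy⟩
    exact hxy (hc.eq_of_covBy_of_covBy hm hm' hn hn' hzx hzy)
  · rintro x ⟨⟨m, hm, hm'⟩, -⟩ y ⟨⟨n, hn, hn'⟩, -⟩ hxy ⟨z, hzx, hzy⟩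
    exact hxy (hc.swap.eq_of_covBy_of_covBy hm.swap hm' hn.swap hn' hzx hzy)
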